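/- **Setting.** Let $d$ be a natural number, $n=(n_1,\dots,n_d)$ and $r=(r_1,\dots,r_d)$. Tensors in $\mathbb R^{n_1\times\dots\times n_d}$ carry the Euclidean norm $\|\cdot\|$ of the vector of entries. $\mathbf{Mat}_i(Y)\in\mathbb R^{n_i\times\prod_{j\ne i}n_j}$ denotes the $i$-mode matricization and $\mathit{Ten}_i$ its inverse; $C\times_{i=1}^d\mathbf U_i$ denotes the tensor with entries $\sum_{j_1,\dots,j_d}c_{j_1\dots j_d}(\mathbf U_1)_{k_1j_1}\cdots(\mathbf U_d)_{k_dj_d}$. Let $\mathcal M$ be the manifold of tensors of multilinear rank $r$, i.e. with $\operatorname{rank}\mathbf{Mat}_i(Y)=r_i$ for all $i$, and let $\mathrm P(Y)$ be the orthogonal projection onto the tangent space of $\mathcal M$ at $Y\in\mathcal M$. **The integrator.** One step of the rank-$r$ Tucker integrator for $\dot Y=F(t,Y)$ from $t_0$ to $t_1=t_0+h$ starts from $Y_0=C_0\times_{i=1}^d\mathbf U_i^0$, where $C_0\in\mathbb R^{r_1\times\dots\times r_d}$ and the $\mathbf U_i^0\in\mathbb R^{n_i\times r_i}$ have orthonormal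 columns. (1) For each $i$: take a QR factorization $\mathbf{Mat}_i(C_0)^\top=\mathbf Q_i\mathbf S_i^{0,\top}$, put $\mathbf V_i^{0,\top}=\mathbf Q_i^\top\bigotimes_{j\ne i}\mathbf U_j^{0,\top}$, solve $\dot{\mathbf K}_i(t)=\mathbf{Mat}_i\big(F(t,\mathit{Ten}_i(\mathbf K_i(t)\mathbf V_i^{0,\top}))\big)\mathbf V_i^0$, $\mathbf K_i(t_0)=\mathbf U_i^0\mathbf S_i^0$, on $[t_0,t_1]$, take a QR factorization $\mathbf K_i(t_1)=\mathbf U_i^1\mathbf R_i^1$ and put $\mathbf M_i=\mathbf U_i^{1,\top}\mathbf U_i^0$. (2) Solve $\dot C(t)=F\big(t,C(t)\times_{i=1}^d\mathbf U_i^1\big)\times_{i=1}^d\mathbf U_i^{1,\top}$, $C(t_0)=C_0\times_{i=1}^d\mathbf M_i$, on $[t_0,t_1]$, and set $C_1=C(t_1)$, $Y_1=C_1\times_{i=1}^d\mathbf U_i^1$. The result $Y_1$ is the starting value of the next step. **Theorem (robust error bound).** For all $d$, $L$, $B$, $T$ there are constants $c_0,c_1,c_2\ge0$, depending only on $L,B,T,d$,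 such that the following holds for all $n$, $r$, $F$, $A$, all $\varepsilon,\delta\ge0$, and $h,\rho>0$. Let $A:[0,T]\to\mathbb R^{n_1\times\dots\times n_d}$ solve $\dot A(t)=F(t,A(t))$, $A(0)=A_0$, and assume: 1. $\|F(t,X)-F(t,X')\|\le L\|X-X'\|$ and $\|F(t,X)\|\le B$ for all tensors $X,X'$ and $0\le t\le T$; 2. $\|(I-\mathrm P(X))F(t,X)\|\le\varepsilon$ for all $0\le t\le T$ and all $X\in\mathcal M$ with $\|X-A(t)\|<\rho$; 3. $Y_0\in\mathcal M$ and $\|Y_0-A_0\|\le\delta$. Let $Y_k$ be obtained after $k$ steps of the integrator with step size $h$ from $Y_0$, and let $t_k=kh$. If $c_0\delta+c_1\varepsilon+c_2h\le\rho$, then for all $k$ with $t_k\le T$ $$\|Y_k-A(t_k)\|\le c_0\delta+c_1\varepsilon+c_2h .$$ In particular the constants are independent of $n$, $r$, $\rho$ and of the singular values of matricizations of the exact or approximate solution. (If condition 2 holds for all $X\in\mathcal M$, the condition on $\rho$ can be dropped.) -/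

import Mathlib

open scoped Matrix Topology

noncomputable section

namespace TuckerIntegrator

/-- Real tensors of size `n 0 × ⋯ × n (d-1)`, with the Euclidean norm of the vector of entries. -/
abbrev Tensor {d : ℕ} (n : Fin d → ℕ) : Type :=
  EuclideanSpace ℝ ((i : Fin d) → Fin (n i))

/-- Multi-indices in all modes except the `i`-th one. -/
abbrev CoIndex {d : ℕ} (n : Fin d → ℕ) (i : Fin d) : Type :=
  (j : {j : Fin d // j ≠ i}) → Fin (n j)

/-- The `i`-mode matricization: rows are indexed by the `i`-th index of the tensor, columns by
all the other indices. -/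
def mat {d : ℕ} {n : Fin d → ℕ} (i : Fin d) (Y : Tensor n) :
    Matrix (Fin (n i)) (CoIndex n i) ℝ :=
  Matrix.of fun a b => Y ((Equiv.piSplitAt i fun j => Fin (n j)).symm (a, b))

/-- The `i`-mode tensorization, the inverse of `mat i`. -/
def ten {d : ℕ} {n : Fin d → ℕ} (i : Fin d) (M : Matrix (Fin (n i)) (CoIndex n i) ℝ) :
    Tensor n :=
  WithLp.toLp 2 fun k =>
    M (Equiv.piSplitAt i (fun j => Fin (n j)) k).1 (Equiv.piSplitAt i (fun j => Fin (n j)) k).2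

theorem ten_mat {d : ℕ} {n : Fin d → ℕ} (i : Fin d) (Y : Tensor n) : ten i (mat i Y) = Y := by
  ext k
  simp only [ten, mat, Matrix.of_apply, Prod.mk.eta, Equiv.symm_apply_apply]

theorem mat_ten {d : ℕ} {n : Fin d → ℕ} (i : Fin d) (M : Matrix (Fin (n i)) (CoIndex n i) ℝ) :
    mat i (ten i M) = M := by
  ext a b
  simp only [ten, mat, Matrix.of_apply, Equiv.apply_symm_apply]

/-- The multilinear (Tucker) product `C ×₁ U₁ ×₂ ⋯ ×_d U_d`. -/
def tucker {d : ℕ} {r n : Fin d → ℕ} (C : Tensor r)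
    (U : (i : Fin d) → Matrix (Fin (n i)) (Fin (r i)) ℝ) : Tensor n :=
  WithLp.toLp 2 fun k => ∑ l : ((i : Fin d) → Fin (r i)), C l * ∏ i, U i (k i) (l i)

/-- The Kronecker product of the matrices `U j`, `j ≠ i`. -/
def kronExcept {d : ℕ} {r n : Fin d → ℕ} (i : Fin d)
    (U : (i : Fin d) → Matrix (Fin (n i)) (Fin (r i)) ℝ) :
    Matrix (CoIndex n i) (CoIndex r i) ℝ :=
  Matrix.of fun b c => ∏ j : {j : Fin d // j ≠ i}, U j (b j) (c j)

/-- The set of tensors of multilinear rank `(r 0, …, r (d-1))`. -/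
def rankManifold {d : ℕ} (n r : Fin d → ℕ) : Set (Tensor n) :=
  {Y | ∀ i, (mat i Y).rank = r i}

/-- The tangent space at `Y` of the manifold of tensors of multilinear rank `r`, consisting of
the velocities at `Y` of `C¹` curves in the manifold. (At points of the manifold these velocities
form a linear subspace, so that taking the span adds nothing.) -/
def tangentSpace {d : ℕ} {n : Fin d → ℕ} (r : Fin d → ℕ) (Y : Tensor n) :
    Submodule ℝ (Tensor n) :=
  Submodule.span ℝ {Z | ∃ γ : ℝ → Tensor n, γ 0 = Y ∧ ContDiffAt ℝ 1 γ 0 ∧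
    (∀ᶠ s in 𝓝 (0 : ℝ), γ s ∈ rankManifold n r) ∧ HasDerivAt γ Z 0}

/-- The orthogonal projection `P(Y)` onto the tangent space at `Y`. -/
def tangentProj {d : ℕ} {n : Fin d → ℕ} (r : Fin d → ℕ) (Y : Tensor n) :
    Tensor n →L[ℝ] Tensor n :=
  (tangentSpace r Y).starProjection

/-- `M = Q R` is a (slim) QR factorization: `Q` has orthonormal columns, and `R` is square and
upper triangular. -/
def IsQR {ι : Type*} [Fintype ι] {r : ℕ} (M Q : Matrix ι (Fin r) ℝ)
    (R : Matrix (Fin r) (Fin r) ℝ) : Prop :=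
  Qᵀ * Q = 1 ∧ R.BlockTriangular id ∧ M = Q * R

/-- The basis update in mode `i`, from `U0 i` to `U1`, over the time interval `[t0, t1]`,
starting from the Tucker tensor with core `C0` and basis matrices `U0`. The QR factorization of
the transposed matricization of the core is `Q * S0ᵀ`, and `V0` has the transpose
`Qᵀ * ⨂_{j ≠ i} (U0 j)ᵀ`. -/
def IsBasisUpdate {d : ℕ} {n r : Fin d → ℕ} (F : ℝ → Tensor n → Tensor n) (t0 t1 : ℝ)
    (C0 : Tensor r) (U0 : (i : Fin d) → Matrix (Fin (n i)) (Fin (r i)) ℝ) (i : Fin d)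
    (U1 : Matrix (Fin (n i)) (Fin (r i)) ℝ) : Prop :=
  ∃ (Q : Matrix (CoIndex r i) (Fin (r i)) ℝ) (S0 R1 : Matrix (Fin (r i)) (Fin (r i)) ℝ)
    (V0 : Matrix (CoIndex n i) (Fin (r i)) ℝ) (K : ℝ → Matrix (Fin (n i)) (Fin (r i)) ℝ),
    IsQR (mat i C0)ᵀ Q S0ᵀ ∧
    V0 = kronExcept i U0 * Q ∧
    K t0 = U0 i * S0 ∧
    (∀ t ∈ Set.Icc t0 t1, ∀ a b, HasDerivWithinAt (fun s => K s a b)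
      ((mat i (F t (ten i (K t * V0ᵀ))) * V0) a b) (Set.Icc t0 t1) t) ∧
    IsQR (K t1) U1 R1

/-- The core update from `C0` to `C1` over the time interval `[t0, t1]`, with the old basis
matrices `U0` and the updated ones `U1`. -/
def IsCoreUpdate {d : ℕ} {n r : Fin d → ℕ} (F : ℝ → Tensor n → Tensor n) (t0 t1 : ℝ)
    (C0 : Tensor r) (U0 U1 : (i : Fin d) → Matrix (Fin (n i)) (Fin (r i)) ℝ)
    (C1 : Tensor r) : Prop :=
  ∃ C : ℝ → Tensor r,
    C t0 = tucker C0 (fun i => (U1 i)ᵀ * U0 i) ∧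
    (∀ t ∈ Set.Icc t0 t1, HasDerivWithinAt C
      (tucker (F t (tucker (C t) U1)) (fun i => (U1 i)ᵀ)) (Set.Icc t0 t1) t) ∧
    C1 = C t1

/-- One step of the Tucker integrator with rank `r` for `Y' = F(t, Y)`, from `Y0` at `t0` to
`Y1` at `t1`. The starting tensor is given in a factorized form with orthonormal bases; the
differential equations of the substeps are solved exactly. -/
def IsStep {d : ℕ} {n : Fin d → ℕ} (r : Fin d → ℕ) (F : ℝ → Tensor n → Tensor n) (t0 t1 : ℝ)
    (Y0 Y1 : Tensor n) : Prop :=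
  ∃ (C0 C1 : Tensor r) (U0 U1 : (i : Fin d) → Matrix (Fin (n i)) (Fin (r i)) ℝ),
    (∀ i, (U0 i)ᵀ * U0 i = 1) ∧
    Y0 = tucker C0 U0 ∧
    (∀ i, IsBasisUpdate F t0 t1 C0 U0 i (U1 i)) ∧
    IsCoreUpdate F t0 t1 C0 U0 U1 C1 ∧
    Y1 = tucker C1 U1

end TuckerIntegrator

end

/-! In mode `i` the flow `W` of the basis update ends in a tensor `W(t₁)` whose matricization has
its column space in the range of `Uᵢ¹` and its row space in the range of `Vᵢ⁰`. A direction
projected onto both orthogonal complements is normal to the manifold at a point with these column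
and row spaces; as `W(t₁)` may have a smaller rank, it is approximated by points of the manifold
whose column and row spaces converge. Hence the doubly projected part of `F(t, W(t₁))` is at most
`ε`, and comparing `W` with `A` shows that `Uᵢ¹` captures `Y₀ + A(t₁) - A(t₀)` up to an error
`O(h (e + ε + h))`, where `e` is the error at `t₀`. The core update is the Galerkin flow in the new
bases, so its local error has the same order, and no singular value has entered. A discrete Gronwall
argument accumulates these errors as long as the iterates stay in the `ρ`-tube around the solution,
which the bound on `ρ` guarantees inductively. -/

noncomputable section

namespace TuckerIntegrator

open Set Filter Module
open scoped NNReal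

section TensorAlgebra

variable {d : ℕ} {q r n : Fin d → ℕ}

theorem tucker_tucker (C : Tensor q) (U : (i : Fin d) → Matrix (Fin (r i)) (Fin (q i)) ℝ)
    (W : (i : Fin d) → Matrix (Fin (n i)) (Fin (r i)) ℝ) :
    tucker (tucker C U) W = tucker C (fun i => W i * U i) := by
  ext k
  simp only [tucker, Matrix.mul_apply, Finset.prod_univ_sum, Fintype.piFinset_univ,
    Finset.sum_mul, Finset.mul_sum]
  rw [Finset.sum_comm]
  refine Finset.sum_congr rfl fun l _ => Finset.sum_congr rfl fun m _ => ?_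
  rw [Finset.prod_mul_distrib]
  ring

theorem tucker_one (C : Tensor n) : tucker C (fun _ => 1) = C := by
  ext k
  simp only [tucker, Matrix.one_apply, Finset.prod_ite_zero, Finset.prod_const_one,
    Finset.mem_univ, true_implies, ← funext_iff (f := k), mul_ite, mul_one, mul_zero,
    Finset.sum_ite_eq, if_true]

theorem continuous_tucker {S : Type*} [TopologicalSpace S] {C : S → Tensor r}
    {U : S → (i : Fin d) → Matrix (Fin (n i)) (Fin (r i)) ℝ} (hC : Continuous C)
    (hU : Continuous U) : Continuous fun s => tucker (C s) (U s) := by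
  refine (PiLp.continuous_toLp 2 _).comp (continuous_pi fun k => ?_)
  refine continuous_finsetSum _ fun l _ => ?_
  refine .mul (by fun_prop) (continuous_finsetProd _ fun i _ => ?_)
  exact (continuous_apply_apply (k i) (l i)).comp ((continuous_apply i).comp hU)

/-- The Tucker product with fixed matrices, as a continuous linear map of the core. -/
def tuckerCLM (U : (i : Fin d) → Matrix (Fin (n i)) (Fin (r i)) ℝ) : Tensor r →L[ℝ] Tensor n :=
  LinearMap.toContinuousLinearMap
    { toFun := fun C => tucker C U
      map_add' := fun X Y => by
        ext k
        simp only [tucker, PiLp.add_apply, add_mul, Finset.sum_add_distrib]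
      map_smul' := fun c X => by
        ext k
        simp only [tucker, PiLp.smul_apply, smul_eq_mul, mul_assoc, Finset.mul_sum,
          RingHom.id_apply] }

@[simp]
theorem tuckerCLM_apply (U : (i : Fin d) → Matrix (Fin (n i)) (Fin (r i)) ℝ) (C : Tensor r) :
    tuckerCLM U C = tucker C U := rfl

theorem adjoint_tuckerCLM (U : (i : Fin d) → Matrix (Fin (n i)) (Fin (r i)) ℝ) :
    (tuckerCLM U).adjoint = tuckerCLM fun i => (U i)ᵀ := by
  refine ((ContinuousLinearMap.eq_adjoint_iff _ _).2 fun Y C => ?_).symm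
  simp only [tuckerCLM_apply, PiLp.inner_apply, tucker, RCLike.inner_apply, conj_trivial,
    Finset.mul_sum, Finset.sum_mul, Matrix.transpose_apply]
  rw [Finset.sum_comm]
  exact Finset.sum_congr rfl fun l _ => Finset.sum_congr rfl fun m _ => by ring

theorem kronExcept_mul (i : Fin d) (W : (i : Fin d) → Matrix (Fin (n i)) (Fin (r i)) ℝ)
    (U : (i : Fin d) → Matrix (Fin (r i)) (Fin (q i)) ℝ) :
    kronExcept i W * kronExcept i U = kronExcept i (fun i => W i * U i) := by
  ext b c
  simp only [kronExcept, Matrix.mul_apply, Matrix.of_apply, Finset.prod_univ_sum,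
    Fintype.piFinset_univ, Finset.prod_mul_distrib]

theorem kronExcept_transpose (i : Fin d) (U : (i : Fin d) → Matrix (Fin (n i)) (Fin (r i)) ℝ) :
    (kronExcept i U)ᵀ = kronExcept i (fun i => (U i)ᵀ) := rfl

theorem kronExcept_one (i : Fin d) :
    kronExcept i (fun j => (1 : Matrix (Fin (n j)) (Fin (n j)) ℝ)) = 1 := by
  ext b c
  simp only [kronExcept, Matrix.of_apply, Matrix.one_apply, Finset.prod_ite_zero,
    Finset.prod_const_one, Finset.mem_univ, true_implies, funext_iff]

theorem kronExcept_update (i : Fin d) (U : (i : Fin d) → Matrix (Fin (n i)) (Fin (r i)) ℝ)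
    (M : Matrix (Fin (n i)) (Fin (r i)) ℝ) :
    kronExcept i (Function.update U i M) = kronExcept i U := by
  ext b c
  simp only [kronExcept, Matrix.of_apply]
  exact Finset.prod_congr rfl fun j _ => by rw [Function.update_of_ne j.2]

theorem transpose_mul_self_kronExcept_mul (i : Fin d)
    {U : (i : Fin d) → Matrix (Fin (n i)) (Fin (r i)) ℝ} (hU : ∀ j, (U j)ᵀ * U j = 1)
    {κ : Type*} [DecidableEq κ] {Q : Matrix (CoIndex r i) κ ℝ} (hQ : Qᵀ * Q = 1) :
    (kronExcept i U * Q)ᵀ * (kronExcept i U * Q) = 1 := by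
  rw [Matrix.transpose_mul, Matrix.mul_assoc, ← Matrix.mul_assoc _ (kronExcept i U),
    kronExcept_transpose, kronExcept_mul]
  simp only [hU, kronExcept_one, Matrix.one_mul, hQ]

theorem mat_tucker (i : Fin d) (C : Tensor r)
    (U : (i : Fin d) → Matrix (Fin (n i)) (Fin (r i)) ℝ) :
    mat i (tucker C U) = U i * mat i C * (kronExcept i U)ᵀ := by
  ext a b
  have split_self (m : Fin d → ℕ) (u : Fin (m i)) (v : CoIndex m i) :
      (Equiv.piSplitAt i fun j => Fin (m j)).symm (u, v) i = u := by simp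
  have split_ne (m : Fin d → ℕ) (u : Fin (m i)) (v : CoIndex m i) (j : {j // j ≠ i}) :
      (Equiv.piSplitAt i fun j => Fin (m j)).symm (u, v) j = v j := by simp [j.2]
  simp only [mat, tucker, kronExcept, Matrix.mul_apply, Matrix.of_apply, Matrix.transpose_apply,
    Finset.sum_mul]
  rw [← (Equiv.piSplitAt i fun j => Fin (r j)).symm.sum_comp, Fintype.sum_prod_type,
    Finset.sum_comm]
  refine Finset.sum_congr rfl fun y _ => Finset.sum_congr rfl fun x _ => ?_
  rw [Fintype.prod_eq_mul_prod_subtype_ne _ i]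
  simp only [split_self, split_ne]
  ring

/-- The `i`-mode matricization as a linear equivalence, with inverse the `i`-mode
tensorization. -/
def matLinearEquiv (i : Fin d) : Tensor n ≃ₗ[ℝ] Matrix (Fin (n i)) (CoIndex n i) ℝ where
  toFun := mat i
  map_add' _ _ := rfl
  map_smul' _ _ := rfl
  invFun := ten i
  left_inv := ten_mat i
  right_inv := mat_ten i

theorem mat_injective (i : Fin d) : Function.Injective (mat (n := n) i) :=
  (matLinearEquiv i).injective

theorem mat_sub (i : Fin d) (X Y : Tensor n) : mat i (X - Y) = mat i X - mat i Y := rfl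

theorem continuous_mat (i : Fin d) : Continuous (mat (n := n) i) :=
  (matLinearEquiv i).toLinearMap.continuous_of_finiteDimensional

theorem continuous_ten (i : Fin d) : Continuous (ten (n := n) i) :=
  (matLinearEquiv i).symm.toLinearMap.continuous_of_finiteDimensional

theorem inner_ten_left (i : Fin d) (M : Matrix (Fin (n i)) (CoIndex n i) ℝ) (X : Tensor n) :
    inner ℝ (ten i M) X = Matrix.trace (Mᵀ * mat i X) := by
  rw [PiLp.inner_apply, ← (Equiv.piSplitAt i fun j => Fin (n j)).symm.sum_comp,
    Fintype.sum_prod_type, Finset.sum_comm]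
  simp only [Matrix.trace, Matrix.diag, Matrix.mul_apply, Matrix.transpose_apply, ten, mat,
    Matrix.of_apply, Equiv.apply_symm_apply, RCLike.inner_apply, conj_trivial, mul_comm]

/-- The linear map that multiplies the `i`-mode matricization by `P` from the left and by `N` from
the right. -/
def sandwich (i : Fin d) (P : Matrix (Fin (n i)) (Fin (n i)) ℝ)
    (N : Matrix (CoIndex n i) (CoIndex n i) ℝ) : Tensor n →L[ℝ] Tensor n :=
  LinearMap.toContinuousLinearMap <| (matLinearEquiv i).symm.toLinearMap ∘ₗ
    mulRightLinearMap _ ℝ N ∘ₗ mulLeftLinearMap _ ℝ P ∘ₗ (matLinearEquiv i).toLinearMap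

theorem sandwich_apply (i : Fin d) (P : Matrix (Fin (n i)) (Fin (n i)) ℝ)
    (N : Matrix (CoIndex n i) (CoIndex n i) ℝ) (X : Tensor n) :
    sandwich i P N X = ten i (P * mat i X * N) := rfl

theorem mat_sandwich (i : Fin d) (P : Matrix (Fin (n i)) (Fin (n i)) ℝ)
    (N : Matrix (CoIndex n i) (CoIndex n i) ℝ) (X : Tensor n) :
    mat i (sandwich i P N X) = P * mat i X * N := mat_ten _ _

theorem sandwich_mul_sandwich (i : Fin d) (P P' : Matrix (Fin (n i)) (Fin (n i)) ℝ)
    (N N' : Matrix (CoIndex n i) (CoIndex n i) ℝ) :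
    sandwich i P N * sandwich i P' N' = sandwich i (P * P') (N' * N) := by
  refine ContinuousLinearMap.ext fun X => mat_injective i ?_
  simp only [mul_apply_eq_comp, mat_sandwich, Matrix.mul_assoc]

theorem one_sub_sandwich_one_left (i : Fin d) (N : Matrix (CoIndex n i) (CoIndex n i) ℝ) :
    1 - sandwich i 1 N = sandwich i 1 (1 - N) := by
  refine ContinuousLinearMap.ext fun X => mat_injective i ?_
  simp only [sub_apply, one_apply_eq_self, mat_sub, mat_sandwich,
    Matrix.one_mul, Matrix.mul_sub, Matrix.mul_one]

theorem one_sub_sandwich_one_right (i : Fin d) (P : Matrix (Fin (n i)) (Fin (n i)) ℝ) :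
    1 - sandwich i P 1 = sandwich i (1 - P) 1 := by
  refine ContinuousLinearMap.ext fun X => mat_injective i ?_
  simp only [sub_apply, one_apply_eq_self, mat_sub, mat_sandwich,
    Matrix.mul_one, Matrix.sub_mul, Matrix.one_mul]

theorem adjoint_sandwich (i : Fin d) (P : Matrix (Fin (n i)) (Fin (n i)) ℝ)
    (N : Matrix (CoIndex n i) (CoIndex n i) ℝ) :
    (sandwich i P N).adjoint = sandwich i Pᵀ Nᵀ := by
  refine ((ContinuousLinearMap.eq_adjoint_iff _ _).2 fun X Y => ?_).symm
  conv_rhs => rw [← ten_mat i X]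
  rw [sandwich_apply, inner_ten_left, inner_ten_left, mat_sandwich, Matrix.transpose_mul,
    Matrix.transpose_mul, Matrix.transpose_transpose, Matrix.transpose_transpose,
    Matrix.mul_assoc, Matrix.trace_mul_comm]
  simp only [Matrix.mul_assoc]

theorem sandwich_one_right (i : Fin d) (P : Matrix (Fin (n i)) (Fin (n i)) ℝ) :
    sandwich i P 1 = tuckerCLM (Function.update (fun _ => 1) i P) := by
  refine ContinuousLinearMap.ext fun X => mat_injective i ?_
  rw [mat_sandwich, tuckerCLM_apply, mat_tucker, Function.update_self, kronExcept_update,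
    kronExcept_one, Matrix.transpose_one]

end TensorAlgebra

section Projections

variable {d : ℕ} {n : Fin d → ℕ}

theorem isStarProjection_iff_transpose {ι : Type*} [Fintype ι] {P : Matrix ι ι ℝ} :
    IsStarProjection P ↔ P * P = P ∧ Pᵀ = P := by
  rw [isStarProjection_iff, IsIdempotentElem, isSelfAdjoint_iff, Matrix.star_eq_conjTranspose,
    Matrix.conjTranspose_eq_transpose_of_trivial]

theorem isStarProjection_mul_transpose {ι κ : Type*} [Fintype ι] [Fintype κ] [DecidableEq κ]
    {V : Matrix ι κ ℝ} (hV : Vᵀ * V = 1) : IsStarProjection (V * Vᵀ) := by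
  refine isStarProjection_iff_transpose.2 ⟨?_, by simp⟩
  rw [Matrix.mul_assoc, ← Matrix.mul_assoc Vᵀ, hV, Matrix.one_mul]

theorem one_sub_mul_transpose_mul {ι κ : Type*} [Fintype ι] [DecidableEq ι] [Fintype κ]
    [DecidableEq κ] {V : Matrix ι κ ℝ} (hV : Vᵀ * V = 1) : (1 - V * Vᵀ) * V = 0 := by
  rw [Matrix.sub_mul, Matrix.mul_assoc, hV, Matrix.one_mul, Matrix.mul_one, sub_self]

theorem isStarProjection_sandwich (i : Fin d) {P : Matrix (Fin (n i)) (Fin (n i)) ℝ}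
    {N : Matrix (CoIndex n i) (CoIndex n i) ℝ} (hP : IsStarProjection P)
    (hN : IsStarProjection N) : IsStarProjection (sandwich i P N) where
  isIdempotentElem := by
    rw [IsIdempotentElem, sandwich_mul_sandwich, hP.isIdempotentElem.eq, hN.isIdempotentElem.eq]
  isSelfAdjoint := by
    rw [ContinuousLinearMap.isSelfAdjoint_iff', adjoint_sandwich,
      (isStarProjection_iff_transpose.1 hP).2, (isStarProjection_iff_transpose.1 hN).2]

theorem isStarProjection_tuckerCLM {P : (i : Fin d) → Matrix (Fin (n i)) (Fin (n i)) ℝ}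
    (hP : ∀ i, IsStarProjection (P i)) : IsStarProjection (tuckerCLM P) where
  isIdempotentElem := by
    refine ContinuousLinearMap.ext fun X => ?_
    simp only [mul_apply_eq_comp, tuckerCLM_apply, tucker_tucker,
      (hP _).isIdempotentElem.eq]
  isSelfAdjoint := by
    simp only [ContinuousLinearMap.isSelfAdjoint_iff', adjoint_tuckerCLM,
      (isStarProjection_iff_transpose.1 (hP _)).2]

theorem norm_sub_tucker_le {P : (i : Fin d) → Matrix (Fin (n i)) (Fin (n i)) ℝ}
    (hP : ∀ i, IsStarProjection (P i)) (X : Tensor n) :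
    ‖X - tucker X P‖ ≤ ∑ i, ‖sandwich i (1 - P i) 1 X‖ := by
  suffices key : ∀ S : Finset (Fin d),
      ‖X - tucker X (S.piecewise P 1)‖ ≤ ∑ i ∈ S, ‖sandwich i (1 - P i) 1 X‖ by
    simpa using key Finset.univ
  intro S
  induction S using Finset.induction_on with
  | empty =>
    rw [Finset.piecewise_empty, Finset.sum_empty]
    exact (norm_sub_eq_zero_iff.2 (tucker_one X).symm).le
  | insert i S hi ih =>
    set PS := S.piecewise P 1
    have hPS : ‖tuckerCLM PS‖ ≤ 1 := by
      refine (isStarProjection_tuckerCLM fun j => ?_).norm_le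
      by_cases hj : j ∈ S
      · simpa [PS, hj] using hP j
      · simp [PS, hj]
    have hinsert : tucker X ((insert i S).piecewise P 1) = tuckerCLM PS (sandwich i (P i) 1 X) := by
      rw [sandwich_one_right, tuckerCLM_apply, tuckerCLM_apply, tucker_tucker]
      congr 1
      funext j
      obtain rfl | hj := eq_or_ne j i
      · simp [PS, hi]
      · simp [PS, hj, Finset.piecewise]
    have hsplit : X - tucker X ((insert i S).piecewise P 1) =
        tuckerCLM PS (sandwich i (1 - P i) 1 X) + (X - tucker X PS) := by
      rw [hinsert, ← one_sub_sandwich_one_right, sub_apply,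
        one_apply_eq_self, map_sub, tuckerCLM_apply PS X]
      abel
    rw [hsplit, Finset.sum_insert hi]
    refine norm_add_le_of_le ?_ ih
    simpa using (tuckerCLM PS).le_of_opNorm_le hPS (sandwich i (1 - P i) 1 X)

end Projections

section Rank

variable {d : ℕ} {r n : Fin d → ℕ}

theorem rank_mat_tucker_le (i : Fin d) (C : Tensor r)
    (U : (i : Fin d) → Matrix (Fin (n i)) (Fin (r i)) ℝ) :
    (mat i (tucker C U)).rank ≤ (mat i C).rank := by
  rw [mat_tucker]
  exact (Matrix.rank_mul_le_left _ _).trans (Matrix.rank_mul_le_right _ _)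

theorem rank_mat_tucker_eq (i : Fin d) (C : Tensor r)
    {U : (i : Fin d) → Matrix (Fin (n i)) (Fin (r i)) ℝ}
    {W : (i : Fin d) → Matrix (Fin (r i)) (Fin (n i)) ℝ} (hWU : ∀ i, W i * U i = 1) :
    (mat i (tucker C U)).rank = (mat i C).rank := by
  refine (rank_mat_tucker_le i C U).antisymm ?_
  simpa only [tucker_tucker, hWU, tucker_one] using rank_mat_tucker_le i (tucker C U) W

theorem exists_transpose_mul_self_eq_one_and_mul_eq {m ι : Type*} [Fintype m] [Fintype ι] {k : ℕ}
    {M : Matrix m ι ℝ} (hM : M.rank = k) :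
    ∃ U : Matrix m (Fin k) ℝ, Uᵀ * U = 1 ∧ U * Uᵀ * M = M := by
  let e := (WithLp.linearEquiv 2 ℝ (m → ℝ)).symm
  let K : Submodule ℝ (EuclideanSpace ℝ m) := (Submodule.span ℝ (range M.col)).map e.toLinearMap
  have hK : finrank ℝ K = k :=
    (e.finrank_map_eq _).trans (M.rank_eq_finrank_span_cols.symm.trans hM)
  let b := (stdOrthonormalBasis ℝ K).reindex (finCongr hK)
  refine ⟨Matrix.of fun a j => (b j : EuclideanSpace ℝ m) a, ?_, ?_⟩
  · ext j l
    have hb := orthonormal_iff_ite.1 b.orthonormal l j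
    rw [Submodule.coe_inner, PiLp.inner_apply] at hb
    simpa [Matrix.mul_apply, Matrix.one_apply, eq_comm] using hb
  · ext a c
    let x : K := ⟨e (M.col c), Submodule.mem_map_of_mem (Submodule.subset_span ⟨c, rfl⟩)⟩
    have hx := congrArg (fun y : K => (y : EuclideanSpace ℝ m) a) (b.sum_repr' x)
    simp only [Submodule.coe_inner, PiLp.inner_apply, Submodule.coe_sum, Submodule.coe_smul,
      WithLp.ofLp_sum, Finset.sum_apply, PiLp.smul_apply, smul_eq_mul] at hx
    rw [Matrix.mul_assoc]
    simp only [Matrix.mul_apply]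
    simpa [x, e, mul_comm] using hx

theorem nonempty_rankManifold_self (h : (rankManifold n r).Nonempty) :
    (rankManifold r r).Nonempty := by
  obtain ⟨Y, hY⟩ := h
  choose U hU hUY using fun i => exists_transpose_mul_self_eq_one_and_mul_eq (hY i)
  have hYU : tucker (tucker Y fun i => (U i)ᵀ) U = Y := by
    rw [tucker_tucker, eq_comm, ← norm_sub_eq_zero_iff]
    refine le_antisymm ?_ (norm_nonneg _)
    refine (norm_sub_tucker_le (fun i => isStarProjection_mul_transpose (hU i)) Y).trans ?_
    refine (Finset.sum_eq_zero fun i _ => ?_).le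
    rw [← one_sub_sandwich_one_right, sub_apply, one_apply_eq_self, sandwich_apply, hUY,
      Matrix.mul_one, ten_mat, sub_self, norm_zero]
  exact ⟨tucker Y fun i => (U i)ᵀ, fun i => by rw [← rank_mat_tucker_eq i _ hU, hYU, hY i]⟩

end Rank

section TangentSpace

variable {d : ℕ} {r n : Fin d → ℕ}

theorem apply_mem_range_of_hasDerivAt {𝕜 E F : Type*} [NontriviallyNormedField 𝕜] [CompleteSpace 𝕜]
    [AddCommGroup E] [Module 𝕜 E] [NormedAddCommGroup F] [NormedSpace 𝕜 F] [FiniteDimensional 𝕜 F]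
    {f : 𝕜 → E →ₗ[𝕜] F} {t₀ : 𝕜} {v : E} {w : F} (hf : ∀ x, ContinuousAt (fun t => f t x) t₀)
    (hw : HasDerivAt (fun t => f t v) w t₀)
    (hrank : ∀ᶠ t in 𝓝[≠] t₀, finrank 𝕜 (f t).range ≤ finrank 𝕜 (f t₀).range)
    (hv : f t₀ v = 0) : w ∈ (f t₀).range := by
  by_contra hmem
  let b := finBasis 𝕜 (f t₀).range
  choose x hx using fun j => (b j).2
  -- The limit of these families as `t → t₀` has one vector more than the rank of `f t₀`.
  let g : 𝕜 → Option (Fin (finrank 𝕜 (f t₀).range)) → F := fun t o =>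
    o.elim (slope (fun t => f t v) t₀ t) fun j => f t (x j)
  let g₀ : Option (Fin (finrank 𝕜 (f t₀).range)) → F := fun o => o.elim w fun j => b j
  have hg : Tendsto g (𝓝[≠] t₀) (𝓝 g₀) := by
    refine tendsto_pi_nhds.2 fun o => ?_
    rcases o with - | j
    · exact hasDerivAt_iff_tendsto_slope.1 hw
    · have := (hf (x j)).tendsto.mono_left (nhdsWithin_le_nhds (s := {t₀}ᶜ))
      rwa [hx j] at this
  have hg₀ : LinearIndependent 𝕜 g₀ := by
    refine linearIndependent_option.2
      ⟨b.linearIndependent.map' (f t₀).range.subtype (Submodule.ker_subtype _), fun h => hmem ?_⟩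
    refine (Submodule.span_le.2 ?_ : Submodule.span 𝕜 _ ≤ (f t₀).range) h
    rintro _ ⟨j, rfl⟩
    exact (b j).2
  obtain ⟨t, htg, htr⟩ := ((hg.eventually hg₀.eventually).and hrank).exists
  have hspan : Submodule.span 𝕜 (range (g t)) ≤ (f t).range := by
    refine Submodule.span_le.2 ?_
    rintro _ ⟨- | j, rfl⟩
    · refine Submodule.smul_mem _ _ (Submodule.sub_mem _ ⟨v, rfl⟩ ?_)
      simp only [hv, Submodule.zero_mem]
    · exact ⟨x j, rfl⟩
  have hcard := (Submodule.finrank_mono hspan).trans htr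
  rw [finrank_span_eq_card htg, Fintype.card_option, Fintype.card_fin] at hcard
  exact absurd hcard (Nat.not_succ_le_self _)

theorem mat_mulVec_mem_range_of_hasDerivAt {γ : ℝ → Tensor n} {Z : Tensor n}
    (hγ : ∀ᶠ s in 𝓝 (0 : ℝ), γ s ∈ rankManifold n r) (hZ : HasDerivAt γ Z 0) (i : Fin d)
    {v : CoIndex n i → ℝ} (hv : mat i (γ 0) *ᵥ v = 0) :
    mat i Z *ᵥ v ∈ (mat i (γ 0)).mulVecLin.range := by
  let mulVecCLM (x : CoIndex n i → ℝ) : Tensor n →L[ℝ] (Fin (n i) → ℝ) :=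
    LinearMap.toContinuousLinearMap
      ((Matrix.mulVecBilin ℝ ℝ).flip x ∘ₗ (matLinearEquiv i).toLinearMap)
  have hrank (s : ℝ) (hs : γ s ∈ rankManifold n r) :
      finrank ℝ (mat i (γ s)).mulVecLin.range = r i := hs i
  refine apply_mem_range_of_hasDerivAt (f := fun s => (mat i (γ s)).mulVecLin)
    (fun x => (mulVecCLM x).continuous.continuousAt.comp hZ.continuousAt)
    ((mulVecCLM v).hasFDerivAt.comp_hasDerivAt 0 hZ) ?_ hv
  filter_upwards [hγ.filter_mono nhdsWithin_le_nhds] with s hs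
  rw [hrank s hs, hrank 0 hγ.self_of_nhds]

theorem tangentSpace_le_ker_sandwich {X : Tensor n} {i : Fin d}
    {P : Matrix (Fin (n i)) (Fin (n i)) ℝ} {N : Matrix (CoIndex n i) (CoIndex n i) ℝ}
    (hP : P * mat i X = 0) (hN : mat i X * N = 0) :
    tangentSpace r X ≤ (sandwich i P N).ker := by
  refine Submodule.span_le.2 ?_
  rintro Z ⟨γ, rfl, -, hγ, hZ⟩
  refine mat_injective i ?_
  ext a c
  have hv : mat i (γ 0) *ᵥ N.col c = 0 := funext fun a => congrFun (congrFun hN a) c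
  obtain ⟨u, hu⟩ := mat_mulVec_mem_range_of_hasDerivAt hγ hZ i hv
  have hPZ : P *ᵥ (mat i Z *ᵥ N.col c) = 0 := by
    rw [← hu, Matrix.mulVecLin_apply, Matrix.mulVec_mulVec, hP, Matrix.zero_mulVec]
  rw [Matrix.mulVec_mulVec] at hPZ
  exact (congrFun₂ (mat_sandwich i P N Z) a c).trans (congrFun hPZ a)

theorem sandwich_mem_orthogonal_tangentSpace {X : Tensor n} {i : Fin d}
    {P : Matrix (Fin (n i)) (Fin (n i)) ℝ} {N : Matrix (CoIndex n i) (CoIndex n i) ℝ}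
    (hP : Pᵀ * mat i X = 0) (hN : mat i X * Nᵀ = 0) (Y : Tensor n) :
    sandwich i P N Y ∈ (tangentSpace r X)ᗮ := by
  refine (Submodule.mem_orthogonal _ _).2 fun Z hZ => ?_
  have hZ0 : sandwich i Pᵀ Nᵀ Z = 0 := tangentSpace_le_ker_sandwich hP hN hZ
  rw [← ContinuousLinearMap.adjoint_inner_left, adjoint_sandwich, hZ0, inner_zero_left]

theorem inner_le_norm_sub_starProjection_mul_norm {E : Type*} [NormedAddCommGroup E]
    [InnerProductSpace ℝ E] (K : Submodule ℝ E) [K.HasOrthogonalProjection] (x : E) {z : E}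
    (hz : z ∈ Kᗮ) : inner ℝ x z ≤ ‖x - K.starProjection x‖ * ‖z‖ := by
  have h0 : inner ℝ (K.starProjection x) z = 0 := hz _ (Submodule.starProjection_apply_mem K x)
  rw [← sub_zero (inner ℝ x z), ← h0, ← inner_sub_left]
  exact real_inner_le_norm _ _

end TangentSpace

section Approximation

theorem eventually_isUnit_add_smul_one {m : Type*} [Fintype m] [DecidableEq m]
    (A : Matrix m m ℝ) : ∀ᶠ s in 𝓝[≠] (0 : ℝ), IsUnit (A + s • (1 : Matrix m m ℝ)) := by
  have hfin : (spectrum ℝ (-A)).Finite := Matrix.finite_spectrum (-A)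
  filter_upwards [nhdsNE_le_cofinite (0 : ℝ) hfin.compl_mem_cofinite] with s hs
  rwa [mem_compl_iff, spectrum.notMem_iff, sub_neg_eq_add, add_comm,
    Algebra.algebraMap_eq_smul_one] at hs

theorem eventually_rank_add_smul {m ι : Type*} [Fintype m] [Fintype ι]
    (A : Matrix m ι ℝ) {B : Matrix m ι ℝ} (hB : B.rank = Fintype.card m) :
    ∀ᶠ s in 𝓝[≠] (0 : ℝ), (A + s • B).rank = Fintype.card m := by
  classical
  have hsurj : Function.Surjective B.mulVec := by
    refine (LinearMap.range_eq_top (f := B.mulVecLin)).1 (Submodule.eq_top_of_finrank_eq ?_)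
    rw [finrank_fintype_fun_eq_card]
    exact hB
  obtain ⟨W, hW⟩ := Matrix.mulVec_surjective_iff_exists_right_inverse.1 hsurj
  filter_upwards [eventually_isUnit_add_smul_one (A * W)] with s hs
  refine (Matrix.rank_le_card_height _).antisymm ?_
  calc Fintype.card m = ((A + s • B) * W).rank := by
        rw [Matrix.add_mul, Matrix.smul_mul, hW, Matrix.rank_of_isUnit _ hs]
    _ ≤ (A + s • B).rank := Matrix.rank_mul_le_left _ _

variable {d : ℕ} {r n : Fin d → ℕ}

theorem eventually_add_smul_mem_rankManifold (G : Tensor r) {H : Tensor r}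
    (hH : H ∈ rankManifold r r) : ∀ᶠ s in 𝓝[≠] (0 : ℝ), G + s • H ∈ rankManifold r r := by
  refine eventually_all.2 fun j => ?_
  have hrank := eventually_rank_add_smul (mat j G) ((hH j).trans (Fintype.card_fin _).symm)
  rwa [Fintype.card_fin] at hrank

theorem mat_tucker_update (i : Fin d) (G : Tensor r)
    (U : (i : Fin d) → Matrix (Fin (n i)) (Fin (r i)) ℝ) (M : Matrix (Fin (n i)) (Fin (r i)) ℝ) :
    mat i (tucker G (Function.update U i M)) = M * (kronExcept i U * (mat i G)ᵀ)ᵀ := by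
  rw [mat_tucker, Function.update_self, kronExcept_update, Matrix.transpose_mul,
    Matrix.transpose_transpose, Matrix.mul_assoc]

theorem tucker_update_mem_rankManifold (i : Fin d) {G : Tensor r} (hG : G ∈ rankManifold r r)
    {U : (i : Fin d) → Matrix (Fin (n i)) (Fin (r i)) ℝ} (hU : ∀ j, (U j)ᵀ * U j = 1)
    {U₁ : Matrix (Fin (n i)) (Fin (r i)) ℝ} (hU₁ : U₁ᵀ * U₁ = 1)
    {R : Matrix (Fin (r i)) (Fin (r i)) ℝ} (hR : IsUnit R) :
    tucker G (Function.update U i (U₁ * R)) ∈ rankManifold n r := by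
  intro j
  rw [← hG j]
  refine rank_mat_tucker_eq j G
    (W := Function.update (fun j => (U j)ᵀ) i (R⁻¹ * U₁ᵀ)) fun l => ?_
  obtain rfl | hl := eq_or_ne l i
  · rw [Function.update_self, Function.update_self, Matrix.mul_assoc, ← Matrix.mul_assoc U₁ᵀ, hU₁,
      Matrix.one_mul, Matrix.nonsing_inv_mul _ ((Matrix.isUnit_iff_isUnit_det R).1 hR)]
  · rw [Function.update_of_ne hl, Function.update_of_ne hl, hU]

/-- The determinant of `Vᵀ * V` times the orthogonal projection onto the orthogonal complement of
the column space of `V`. The scaling makes it polynomial in `V`, hence continuous also where the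
columns of `V` become linearly dependent. -/
def scaledComplProj {ι κ : Type*} [Fintype ι] [DecidableEq ι] [Fintype κ] [DecidableEq κ]
    (V : Matrix ι κ ℝ) : Matrix ι ι ℝ :=
  (Vᵀ * V).det • 1 - V * (Vᵀ * V).adjugate * Vᵀ

section ScaledComplProj

variable {ι κ : Type*} [Fintype ι] [DecidableEq ι] [Fintype κ] [DecidableEq κ]

theorem transpose_mul_scaledComplProj (V : Matrix ι κ ℝ) : Vᵀ * scaledComplProj V = 0 := by
  rw [scaledComplProj, Matrix.mul_sub, ← Matrix.mul_assoc, ← Matrix.mul_assoc, Matrix.mul_adjugate,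
    Matrix.mul_smul, Matrix.smul_mul, Matrix.mul_one, Matrix.one_mul, sub_self]

theorem scaledComplProj_transpose (V : Matrix ι κ ℝ) :
    (scaledComplProj V)ᵀ = scaledComplProj V := by
  simp only [scaledComplProj, Matrix.transpose_sub, Matrix.transpose_smul, Matrix.transpose_one,
    Matrix.transpose_mul, Matrix.transpose_transpose, Matrix.adjugate_transpose, Matrix.mul_assoc]

theorem scaledComplProj_of_transpose_mul_self {V : Matrix ι κ ℝ} (hV : Vᵀ * V = 1) :
    scaledComplProj V = 1 - V * Vᵀ := by
  simp [scaledComplProj, hV]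

theorem continuous_scaledComplProj :
    Continuous (scaledComplProj : Matrix ι κ ℝ → Matrix ι ι ℝ) := by
  unfold scaledComplProj
  fun_prop

end ScaledComplProj

theorem norm_sandwich_le_of_tendsto {S : Type*} {l : Filter S} [l.NeBot] {i : Fin d}
    {X : S → Tensor n} {X₀ : Tensor n} (hX : Tendsto X l (𝓝[rankManifold n r] X₀))
    {P : Matrix (Fin (n i)) (Fin (n i)) ℝ} (hP : IsStarProjection P)
    (hPX : ∀ s, P * mat i (X s) = 0)
    {N : S → Matrix (CoIndex n i) (CoIndex n i) ℝ} {N₀ : Matrix (CoIndex n i) (CoIndex n i) ℝ}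
    (hN : Tendsto N l (𝓝 N₀)) (hN₀ : IsStarProjection N₀) (hXN : ∀ s, mat i (X s) * (N s)ᵀ = 0)
    {f : Tensor n → Tensor n} (hf : ContinuousAt f X₀) {ε : ℝ}
    (hε : ∀ᶠ Y in 𝓝[rankManifold n r] X₀, ‖f Y - tangentProj r Y (f Y)‖ ≤ ε) :
    ‖sandwich i P N₀ (f X₀)‖ ≤ ε := by
  set z₀ := sandwich i P N₀ (f X₀)
  have hz : Tendsto (fun s => sandwich i P (N s) (f X₀)) l (𝓝 z₀) := by
    have : Continuous fun N => sandwich i P N (f X₀) :=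
      (continuous_ten i).comp (continuous_const.matrix_mul continuous_id)
    exact (this.tendsto N₀).comp hN
  have hfX : Tendsto (fun s => f (X s)) l (𝓝 (f X₀)) :=
    hf.tendsto.comp (hX.mono_right nhdsWithin_le_nhds)
  have hinner : ∀ᶠ s in l, inner ℝ (f (X s)) (sandwich i P (N s) (f X₀)) ≤
      ε * ‖sandwich i P (N s) (f X₀)‖ := by
    filter_upwards [hX.eventually hε] with s hs
    have hPt : Pᵀ * mat i (X s) = 0 := by rw [(isStarProjection_iff_transpose.1 hP).2, hPX]
    refine (inner_le_norm_sub_starProjection_mul_norm (tangentSpace r (X s)) (f (X s))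
      (sandwich_mem_orthogonal_tangentSpace hPt (hXN s) (f X₀))).trans ?_
    exact mul_le_mul_of_nonneg_right hs (norm_nonneg _)
  have hsq : ‖z₀‖ * ‖z₀‖ ≤ ε * ‖z₀‖ := by
    have hproj := isStarProjection_sandwich i hP hN₀
    calc ‖z₀‖ * ‖z₀‖ = inner ℝ (f X₀) z₀ := by
          rw [← real_inner_self_eq_norm_mul_norm, ← ContinuousLinearMap.adjoint_inner_right,
            hproj.isSelfAdjoint.adjoint_eq, ← mul_apply_eq_comp, hproj.isIdempotentElem.eq]
      _ ≤ ε * ‖z₀‖ := le_of_tendsto_of_tendsto (hfX.inner hz) (hz.norm.const_mul ε) hinner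
  obtain hz₀ | hz₀ := (norm_nonneg z₀).eq_or_lt
  · obtain ⟨s, hs⟩ := (hX.eventually hε).exists
    exact hz₀.ge.trans ((norm_nonneg _).trans hs)
  · exact le_of_mul_le_mul_right hsq hz₀

theorem norm_sandwich_le_of_normal_part_le (hr : (rankManifold r r).Nonempty) {i : Fin d}
    {U₀ : (i : Fin d) → Matrix (Fin (n i)) (Fin (r i)) ℝ} (hU₀ : ∀ j, (U₀ j)ᵀ * U₀ j = 1)
    {Q : Matrix (CoIndex r i) (Fin (r i)) ℝ} (hQ : Qᵀ * Q = 1)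
    {U₁ : Matrix (Fin (n i)) (Fin (r i)) ℝ} (hU₁ : U₁ᵀ * U₁ = 1)
    {R : Matrix (Fin (r i)) (Fin (r i)) ℝ}
    {V : Matrix (CoIndex n i) (Fin (r i)) ℝ} (hV : V = kronExcept i U₀ * Q)
    {f : Tensor n → Tensor n} (hf : ContinuousAt f (ten i (U₁ * R * Vᵀ))) {ε : ℝ}
    (hε : ∀ᶠ Y in 𝓝[rankManifold n r] (ten i (U₁ * R * Vᵀ)),
      ‖f Y - tangentProj r Y (f Y)‖ ≤ ε) :
    ‖sandwich i (1 - U₁ * U₁ᵀ) (1 - V * Vᵀ) (f (ten i (U₁ * R * Vᵀ)))‖ ≤ ε := by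
  obtain ⟨H, hH⟩ := hr
  have hVV : Vᵀ * V = 1 := hV ▸ transpose_mul_self_kronExcept_mul i hU₀ hQ
  let G (s : ℝ) : Tensor r := ten i Qᵀ + s • H
  let X (s : ℝ) : Tensor n := tucker (G s) (Function.update U₀ i (U₁ * (R + s • 1)))
  let W (s : ℝ) : Matrix (CoIndex n i) (Fin (r i)) ℝ := kronExcept i U₀ * (mat i (G s))ᵀ
  have hmatX (s : ℝ) : mat i (X s) = U₁ * (R + s • 1) * (W s)ᵀ := mat_tucker_update i _ _ _
  have hG : Continuous G := by fun_prop
  have hX : Continuous X := continuous_tucker hG (continuous_const.update i (by fun_prop))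
  have hW : Continuous W :=
    continuous_const.matrix_mul ((continuous_mat i).comp hG).matrix_transpose
  have hW0 : W 0 = V := by
    simp only [W, G, zero_smul, add_zero, mat_ten, Matrix.transpose_transpose, hV]
  have hX0 : X 0 = ten i (U₁ * R * Vᵀ) :=
    mat_injective i (by rw [hmatX, hW0, mat_ten, zero_smul, add_zero])
  have hXM : ∀ᶠ s in 𝓝[≠] (0 : ℝ), X s ∈ rankManifold n r := by
    filter_upwards [eventually_add_smul_mem_rankManifold (ten i Qᵀ) hH,
      eventually_isUnit_add_smul_one R] with s hGs hRs
    exact tucker_update_mem_rankManifold i hGs hU₀ hU₁ hRs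
  refine norm_sandwich_le_of_tendsto (l := 𝓝[≠] (0 : ℝ)) (X := X)
    (N := fun s => scaledComplProj (W s)) ?_ (isStarProjection_mul_transpose hU₁).one_sub
    (fun s => ?_) ?_ (isStarProjection_mul_transpose hVV).one_sub (fun s => ?_) hf hε
  · exact tendsto_nhdsWithin_iff.2 ⟨hX0 ▸ (hX.tendsto 0).mono_left nhdsWithin_le_nhds, hXM⟩
  · rw [hmatX, ← Matrix.mul_assoc, ← Matrix.mul_assoc, one_sub_mul_transpose_mul hU₁,
      Matrix.zero_mul, Matrix.zero_mul]
  · rw [← scaledComplProj_of_transpose_mul_self hVV, ← hW0]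
    exact ((continuous_scaledComplProj.comp hW).tendsto 0).mono_left nhdsWithin_le_nhds
  · rw [hmatX, scaledComplProj_transpose, Matrix.mul_assoc, transpose_mul_scaledComplProj,
      Matrix.mul_zero]

end Approximation

section IntegralCurves

variable {E : Type*} [NormedAddCommGroup E] [NormedSpace ℝ E] {v w F : ℝ → E → E}
  {γ η A : ℝ → E} {t₀ t₁ B ε θ : ℝ} {L : ℝ≥0}

theorem norm_sub_le_of_isIntegralCurveOn (hγ : IsIntegralCurveOn γ v (Icc t₀ t₁))
    (hB : ∀ t ∈ Icc t₀ t₁, ‖v t (γ t)‖ ≤ B) {t : ℝ} (ht : t ∈ Icc t₀ t₁) :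
    ‖γ t - γ t₀‖ ≤ B * (t₁ - t₀) := by
  have hB0 : 0 ≤ B := (norm_nonneg _).trans (hB t ht)
  calc ‖γ t - γ t₀‖ ≤ B * (t - t₀) :=
        norm_image_sub_le_of_norm_deriv_le_segment' hγ (fun s hs => hB s (Ico_subset_Icc_self hs))
          t ht
    _ ≤ B * (t₁ - t₀) := by gcongr; exact ht.2

theorem norm_sub_le_of_isIntegralCurveOn₂ (hγ : IsIntegralCurveOn γ v (Icc t₀ t₁))
    (hη : IsIntegralCurveOn η w (Icc t₀ t₁)) (hv : ∀ t ∈ Icc t₀ t₁, ‖v t (γ t)‖ ≤ B)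
    (hw : ∀ t ∈ Icc t₀ t₁, ‖w t (η t)‖ ≤ B) {s t : ℝ} (hs : s ∈ Icc t₀ t₁)
    (ht : t ∈ Icc t₀ t₁) : ‖γ s - η t‖ ≤ ‖γ t₀ - η t₀‖ + 2 * B * (t₁ - t₀) := by
  have hsplit : γ s - η t = (γ s - γ t₀) + (γ t₀ - η t₀) - (η t - η t₀) := by abel
  rw [hsplit]
  linarith [norm_sub_le ((γ s - γ t₀) + (γ t₀ - η t₀)) (η t - η t₀),
    norm_add_le (γ s - γ t₀) (γ t₀ - η t₀), norm_sub_le_of_isIntegralCurveOn hγ hv hs,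
    norm_sub_le_of_isIntegralCurveOn hη hw ht]

theorem norm_apply_sub_apply_le {p q : E →L[ℝ] E} (hp : ‖p‖ ≤ 1) (hp' : ‖1 - p‖ ≤ 1) (hq : ‖q‖ ≤ 1)
    (x y z : E) : ‖q (x - p y)‖ ≤ ‖x - y‖ + ‖x - z‖ + ‖(q * (1 - p)) z‖ := by
  have hsplit : q (x - p y) = q (p (x - y)) + q ((1 - p) (x - z)) + (q * (1 - p)) z := by
    simp only [mul_apply_eq_comp, sub_apply, one_apply_eq_self, map_sub]
    abel
  have norm_le {f : E →L[ℝ] E} (hf : ‖f‖ ≤ 1) (w : E) : ‖f w‖ ≤ ‖w‖ := by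
    simpa using f.le_of_opNorm_le hf w
  rw [hsplit]
  refine norm_add₃_le.trans (add_le_add_left (add_le_add ?_ ?_) _)
  · exact (norm_le hq _).trans (norm_le hp _)
  · exact (norm_le hq _).trans (norm_le hp' _)

theorem norm_apply_add_increment_le_of_apply_eq_zero (ht : t₀ ≤ t₁)
    (hA : IsIntegralCurveOn A F (Icc t₀ t₁)) (hL : ∀ t ∈ Icc t₀ t₁, LipschitzWith L (F t))
    (hB : ∀ t ∈ Icc t₀ t₁, ∀ X, ‖F t X‖ ≤ B) {p q : E →L[ℝ] E} (hp : ‖p‖ ≤ 1) (hp' : ‖1 - p‖ ≤ 1)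
    (hq : ‖q‖ ≤ 1) (hγ : IsIntegralCurveOn γ (fun t X => p (F t X)) (Icc t₀ t₁))
    (hqγ : q (γ t₁) = 0) (hε : ∀ t ∈ Icc t₀ t₁, ‖(q * (1 - p)) (F t (γ t₁))‖ ≤ ε) :
    ‖q (γ t₀ + (A t₁ - A t₀))‖ ≤
      (2 * L * (‖γ t₀ - A t₀‖ + 2 * B * (t₁ - t₀)) + ε) * (t₁ - t₀) := by
  set M := ‖γ t₀ - A t₀‖ + 2 * B * (t₁ - t₀)
  have hpB (t : ℝ) (ht : t ∈ Icc t₀ t₁) : ‖p (F t (γ t))‖ ≤ B :=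
    (p.le_of_opNorm_le hp _).trans (by simpa using hB t ht _)
  have hdist {s t : ℝ} (hs : s ∈ Icc t₀ t₁) (ht : t ∈ Icc t₀ t₁) :
      ‖F t (A t) - F t (γ s)‖ ≤ L * M := by
    refine ((hL t ht).norm_sub_le _ _).trans (mul_le_mul_of_nonneg_left ?_ L.coe_nonneg)
    rw [norm_sub_rev]
    exact norm_sub_le_of_isIntegralCurveOn₂ hγ hA hpB (fun t ht => hB t ht _) hs ht
  have hderiv (t : ℝ) (ht : t ∈ Icc t₀ t₁) : HasDerivWithinAt (fun t => q (A t - γ t))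
      (q (F t (A t) - p (F t (γ t)))) (Icc t₀ t₁) t :=
    q.hasFDerivAt.comp_hasDerivWithinAt t ((hA t ht).sub (hγ t ht))
  have hbound (t : ℝ) (ht : t ∈ Icc t₀ t₁) :
      ‖q (F t (A t) - p (F t (γ t)))‖ ≤ 2 * L * M + ε := by
    linarith [norm_apply_sub_apply_le hp hp' hq (F t (A t)) (F t (γ t)) (F t (γ t₁)),
      hdist ht ht, hdist (right_mem_Icc.2 (ht.1.trans ht.2)) ht, hε t ht]
  have hincr : q (γ t₀ + (A t₁ - A t₀)) = q (A t₁ - γ t₁) - q (A t₀ - γ t₀) := by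
    simp only [map_add, map_sub, hqγ]
    abel
  rw [hincr]
  exact norm_image_sub_le_of_norm_deriv_le_segment' hderiv
    (fun t ht => hbound t (Ico_subset_Icc_self ht)) t₁ (right_mem_Icc.2 ht)

theorem norm_sub_add_increment_le_of_projected_flow (ht : t₀ ≤ t₁)
    (hA : IsIntegralCurveOn A F (Icc t₀ t₁)) (hL : ∀ t ∈ Icc t₀ t₁, LipschitzWith L (F t))
    (hB : ∀ t ∈ Icc t₀ t₁, ∀ X, ‖F t X‖ ≤ B) {p : E →L[ℝ] E} (hp : ‖p‖ ≤ 1)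
    (hγ : IsIntegralCurveOn γ (fun t X => p (F t X)) (Icc t₀ t₁)) {Y : E} (hY : γ t₀ = p Y)
    (hθ : ‖Y + (A t₁ - A t₀) - p (Y + (A t₁ - A t₀))‖ ≤ θ) :
    ‖γ t₁ - (Y + (A t₁ - A t₀))‖ ≤
      θ + L * (‖Y - A t₀‖ + 4 * B * (t₁ - t₀) + θ) * (t₁ - t₀) := by
  set X := Y + (A t₁ - A t₀) with hX
  set M := ‖Y - A t₀‖ + 4 * B * (t₁ - t₀) + θ
  have hp1 (X : E) : ‖p X‖ ≤ ‖X‖ := by simpa using p.le_of_opNorm_le hp X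
  have hinit : ‖γ t₀ - A t₀‖ ≤ ‖Y - A t₀‖ + 2 * B * (t₁ - t₀) + θ := by
    have hsplit : γ t₀ - A t₀ =
        (A t₁ - A t₀) - p (A t₁ - A t₀) - (X - p X) + (Y - A t₀) := by
      rw [hY, hX, map_add]
      abel
    rw [hsplit]
    linarith [norm_add_le ((A t₁ - A t₀) - p (A t₁ - A t₀) - (X - p X)) (Y - A t₀),
      norm_sub_le ((A t₁ - A t₀) - p (A t₁ - A t₀)) (X - p X),
      norm_sub_le (A t₁ - A t₀) (p (A t₁ - A t₀)), hp1 (A t₁ - A t₀),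
      norm_sub_le_of_isIntegralCurveOn hA (fun t ht => hB t ht _) (right_mem_Icc.2 ht)]
  have hderiv (t : ℝ) (ht : t ∈ Icc t₀ t₁) : HasDerivWithinAt (fun t => γ t - p (A t))
      (p (F t (γ t)) - p (F t (A t))) (Icc t₀ t₁) t :=
    (hγ t ht).sub (p.hasFDerivAt.comp_hasDerivWithinAt t (hA t ht))
  have hbound (t : ℝ) (ht : t ∈ Icc t₀ t₁) : ‖p (F t (γ t)) - p (F t (A t))‖ ≤ L * M := by
    rw [← map_sub]
    refine (hp1 _).trans (((hL t ht).norm_sub_le _ _).trans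
      (mul_le_mul_of_nonneg_left ?_ L.coe_nonneg))
    linarith [norm_sub_le_of_isIntegralCurveOn₂ hγ hA
      (fun t ht => (hp1 _).trans (hB t ht _)) (fun t ht => hB t ht _) ht ht]
  have hsplit : γ t₁ - X = (γ t₁ - p (A t₁) - (γ t₀ - p (A t₀))) - (X - p X) := by
    rw [hY, hX, map_add, map_sub]
    abel
  rw [hsplit]
  linarith [norm_sub_le (γ t₁ - p (A t₁) - (γ t₀ - p (A t₀))) (X - p X),
    norm_image_sub_le_of_norm_deriv_le_segment' hderiv
      (fun t ht => hbound t (Ico_subset_Icc_self ht)) t₁ (right_mem_Icc.2 ht)]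

end IntegralCurves

theorem discrete_gronwall_of_le {e : ℕ → ℝ} {a b M : ℝ} {N : ℕ} (he : ∀ k, 0 ≤ e k) (ha : 0 ≤ a)
    (hb : 0 ≤ b) (hM : Real.exp (N * a) * (e 0 + N * b) ≤ M)
    (hstep : ∀ k < N, e k ≤ M → e (k + 1) ≤ (1 + a) * e k + b) :
    e N ≤ Real.exp (N * a) * (e 0 + N * b) := by
  have hmono {k : ℕ} (hk : k ≤ N) :
      Real.exp (k * a) * (e 0 + k * b) ≤ Real.exp (N * a) * (e 0 + N * b) := by
    have := he 0
    gcongr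
  suffices key : ∀ k ≤ N, e k ≤ Real.exp (k * a) * (e 0 + k * b) from key N le_rfl
  intro k
  induction k with
  | zero => simp
  | succ k ih =>
    intro hk
    have hek := ih (Nat.le_of_succ_le hk)
    have hk0 := he k
    calc e (k + 1) ≤ (1 + a) * e k + b :=
          hstep k hk (hek.trans ((hmono (Nat.le_of_succ_le hk)).trans hM))
      _ ≤ Real.exp a * (Real.exp (k * a) * (e 0 + k * b)) + Real.exp ((k + 1) * a) * b := by
          gcongr
          · linarith [Real.add_one_le_exp a]
          · exact le_mul_of_one_le_left hb (Real.one_le_exp (by positivity))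
      _ = Real.exp ((k + 1 : ℕ) * a) * (e 0 + (k + 1 : ℕ) * b) := by
          push_cast
          rw [add_one_mul (k : ℝ) a, Real.exp_add]
          ring

section Integrator

variable {d : ℕ} {r n : Fin d → ℕ} {F : ℝ → Tensor n → Tensor n} {A : ℝ → Tensor n}
  {t₀ t₁ ε ρ : ℝ} {L B : ℝ≥0} {C₀ C₁ : Tensor r}
  {U₀ U₁ : (i : Fin d) → Matrix (Fin (n i)) (Fin (r i)) ℝ} {Y₀ Y₁ : Tensor n}

/-- The standing assumptions of the error analysis on a set `s` of times: `A` solves `Y' = F(t, Y)`,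
and `F` is `L`-Lipschitz, bounded by `B`, and has a normal part of norm at most `ε` at the points
of the manifold of tensors of multilinear rank `r` within distance `ρ` of the solution. -/
structure IsNearlyTangentialFlow (r : Fin d → ℕ) (F : ℝ → Tensor n → Tensor n) (A : ℝ → Tensor n)
    (s : Set ℝ) (L B : ℝ≥0) (ε ρ : ℝ) : Prop where
  isIntegralCurveOn : IsIntegralCurveOn A F s
  lipschitzWith : ∀ t ∈ s, LipschitzWith L (F t)
  norm_le : ∀ t ∈ s, ∀ X, ‖F t X‖ ≤ B
  normal_part_le : ∀ t ∈ s, ∀ X ∈ rankManifold n r, ‖X - A t‖ < ρ →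
    ‖F t X - tangentProj r X (F t X)‖ ≤ ε

theorem IsNearlyTangentialFlow.mono {s s' : Set ℝ}
    (h : IsNearlyTangentialFlow r F A s L B ε ρ) (hs : s' ⊆ s) :
    IsNearlyTangentialFlow r F A s' L B ε ρ where
  isIntegralCurveOn := h.isIntegralCurveOn.mono hs
  lipschitzWith t ht := h.lipschitzWith t (hs ht)
  norm_le t ht := h.norm_le t (hs ht)
  normal_part_le t ht := h.normal_part_le t (hs ht)

theorem hasDerivWithinAt_ten_mul {i : Fin d} {κ : Type*} [Fintype κ]
    {K : ℝ → Matrix (Fin (n i)) κ ℝ} {K' : Matrix (Fin (n i)) κ ℝ} {s : Set ℝ} {t : ℝ}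
    (hK : ∀ a b, HasDerivWithinAt (fun s => K s a b) (K' a b) s t)
    (V : Matrix κ (CoIndex n i) ℝ) :
    HasDerivWithinAt (fun s => ten i (K s * V)) (ten i (K' * V)) s t := by
  refine (PiLp.continuousLinearEquiv 2 ℝ fun _ : (i : Fin d) → Fin (n i) =>
    ℝ).symm.hasFDerivAt.comp_hasDerivWithinAt t (hasDerivWithinAt_pi.2 fun k => ?_)
  simp only [Matrix.mul_apply]
  exact HasDerivWithinAt.fun_sum fun b _ => (hK _ b).mul_const _

theorem IsBasisUpdate.exists_isIntegralCurveOn {i : Fin d}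
    {U : Matrix (Fin (n i)) (Fin (r i)) ℝ} (h : IsBasisUpdate F t₀ t₁ C₀ U₀ i U) :
    ∃ (Q : Matrix (CoIndex r i) (Fin (r i)) ℝ) (R : Matrix (Fin (r i)) (Fin (r i)) ℝ)
      (V : Matrix (CoIndex n i) (Fin (r i)) ℝ) (W : ℝ → Tensor n),
      Qᵀ * Q = 1 ∧ V = kronExcept i U₀ * Q ∧
      IsIntegralCurveOn W (fun t X => sandwich i 1 (V * Vᵀ) (F t X)) (Icc t₀ t₁) ∧
      W t₀ = tucker C₀ U₀ ∧ W t₁ = ten i (U * R * Vᵀ) := by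
  obtain ⟨Q, S, R, V, K, ⟨hQ, -, hC₀⟩, hV, hK₀, hK, -, -, hK₁⟩ := h
  refine ⟨Q, R, V, fun t => ten i (K t * Vᵀ), hQ, hV, fun t ht => ?_, ?_,
    congrArg (fun M => ten i (M * Vᵀ)) hK₁⟩
  · simp only [sandwich_apply, Matrix.one_mul, ← Matrix.mul_assoc]
    exact hasDerivWithinAt_ten_mul (hK t ht) Vᵀ
  · have hC₀' : mat i C₀ = S * Qᵀ := by
      rw [← Matrix.transpose_transpose (mat i C₀), hC₀, Matrix.transpose_mul,
        Matrix.transpose_transpose]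
    refine mat_injective i ?_
    simp only [mat_ten, mat_tucker, hK₀, hC₀', hV, Matrix.transpose_mul, Matrix.mul_assoc]

theorem IsBasisUpdate.transpose_mul_self {i : Fin d} {U : Matrix (Fin (n i)) (Fin (r i)) ℝ}
    (h : IsBasisUpdate F t₀ t₁ C₀ U₀ i U) : Uᵀ * U = 1 := by
  obtain ⟨-, -, -, -, -, -, -, -, -, hU, -⟩ := h
  exact hU

theorem IsBasisUpdate.mode_defect_le (hr : (rankManifold r r).Nonempty) (ht : t₀ ≤ t₁)
    (hF : IsNearlyTangentialFlow r F A (Icc t₀ t₁) L B ε ρ)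
    (hU₀ : ∀ j, (U₀ j)ᵀ * U₀ j = 1)
    (hρ : ‖tucker C₀ U₀ - A t₀‖ + 2 * B * (t₁ - t₀) < ρ) {i : Fin d}
    {U : Matrix (Fin (n i)) (Fin (r i)) ℝ} (h : IsBasisUpdate F t₀ t₁ C₀ U₀ i U) :
    ‖sandwich i (1 - U * Uᵀ) 1 (tucker C₀ U₀ + (A t₁ - A t₀))‖ ≤
      (2 * L * (‖tucker C₀ U₀ - A t₀‖ + 2 * B * (t₁ - t₀)) + ε) * (t₁ - t₀) := by
  obtain ⟨Q, R, V, W, hQ, hV, hW, hW₀, hW₁⟩ := h.exists_isIntegralCurveOn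
  have hU := h.transpose_mul_self
  have hVV : Vᵀ * V = 1 := hV ▸ transpose_mul_self_kronExcept_mul i hU₀ hQ
  have hp := isStarProjection_sandwich i (.one _) (isStarProjection_mul_transpose hVV)
  have hq := isStarProjection_sandwich i (isStarProjection_mul_transpose hU).one_sub (.one _)
  have hdist (t : ℝ) (ht : t ∈ Icc t₀ t₁) : ‖W t₁ - A t‖ < ρ := by
    refine (norm_sub_le_of_isIntegralCurveOn₂ hW hF.isIntegralCurveOn (fun t ht => ?_)
      (fun t ht => hF.norm_le t ht _) (right_mem_Icc.2 (ht.1.trans ht.2)) ht).trans_lt (hW₀ ▸ hρ)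
    exact ((sandwich i 1 (V * Vᵀ)).le_of_opNorm_le hp.norm_le _).trans
      (by simpa using hF.norm_le t ht _)
  rw [← hW₀]
  refine norm_apply_add_increment_le_of_apply_eq_zero ht hF.isIntegralCurveOn hF.lipschitzWith
    hF.norm_le hp.norm_le hp.one_sub.norm_le hq.norm_le hW ?_ fun t ht => ?_
  · refine mat_injective i ?_
    rw [mat_sandwich, hW₁, mat_ten, ← Matrix.mul_assoc, ← Matrix.mul_assoc,
      one_sub_mul_transpose_mul hU, Matrix.zero_mul, Matrix.zero_mul, Matrix.zero_mul]
    rfl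
  · rw [one_sub_sandwich_one_left, sandwich_mul_sandwich, Matrix.mul_one, Matrix.mul_one]
    have hnear : ∀ᶠ X in 𝓝[rankManifold n r] (W t₁), ‖F t X - tangentProj r X (F t X)‖ ≤ ε := by
      have hball : ∀ᶠ X in 𝓝 (W t₁), ‖X - A t‖ < ρ :=
        Tendsto.eventually_lt_const (hdist t ht)
          (continuous_id.sub continuous_const).norm.continuousAt
      filter_upwards [self_mem_nhdsWithin, nhdsWithin_le_nhds hball] with X hX hXA
      exact hF.normal_part_le t ht X hX hXA
    rw [hW₁] at hnear ⊢
    exact norm_sandwich_le_of_normal_part_le hr hU₀ hQ hU hV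
      (hF.lipschitzWith t ht).continuous.continuousAt hnear

theorem IsCoreUpdate.exists_isIntegralCurveOn (h : IsCoreUpdate F t₀ t₁ C₀ U₀ U₁ C₁) :
    ∃ Z : ℝ → Tensor n,
      IsIntegralCurveOn Z (fun t X => tuckerCLM (fun i => U₁ i * (U₁ i)ᵀ) (F t X)) (Icc t₀ t₁) ∧
      Z t₀ = tuckerCLM (fun i => U₁ i * (U₁ i)ᵀ) (tucker C₀ U₀) ∧ Z t₁ = tucker C₁ U₁ := by
  obtain ⟨C, hC₀, hC, rfl⟩ := h
  refine ⟨fun t => tucker (C t) U₁, fun t ht => ?_, ?_, rfl⟩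
  · have hZ := (tuckerCLM U₁).hasFDerivAt.comp_hasDerivWithinAt t (hC t ht)
    rwa [tuckerCLM_apply, tucker_tucker] at hZ
  · simp only [hC₀, tuckerCLM_apply, tucker_tucker, Matrix.mul_assoc]

theorem IsStep.local_error_le (hr : (rankManifold r r).Nonempty) (ht : t₀ ≤ t₁)
    (hF : IsNearlyTangentialFlow r F A (Icc t₀ t₁) L B ε ρ)
    (hρ : ‖Y₀ - A t₀‖ + 2 * B * (t₁ - t₀) < ρ) (h : IsStep r F t₀ t₁ Y₀ Y₁) {θ : ℝ}
    (hθ : d * ((2 * L * (‖Y₀ - A t₀‖ + 2 * B * (t₁ - t₀)) + ε) * (t₁ - t₀)) = θ) :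
    ‖Y₁ - (Y₀ + (A t₁ - A t₀))‖ ≤ θ + L * (‖Y₀ - A t₀‖ + 4 * B * (t₁ - t₀) + θ) * (t₁ - t₀) := by
  obtain ⟨C₀, C₁, U₀, U₁, hU₀, rfl, hbasis, hcore, rfl⟩ := h
  obtain ⟨Z, hZ, hZ₀, hZ₁⟩ := hcore.exists_isIntegralCurveOn
  have hP (i : Fin d) : IsStarProjection (U₁ i * (U₁ i)ᵀ) :=
    isStarProjection_mul_transpose (hbasis i).transpose_mul_self
  rw [← hZ₁]
  refine norm_sub_add_increment_le_of_projected_flow ht hF.isIntegralCurveOn hF.lipschitzWith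
    hF.norm_le (isStarProjection_tuckerCLM hP).norm_le hZ hZ₀ ?_
  calc _ ≤ ∑ i, ‖sandwich i (1 - U₁ i * (U₁ i)ᵀ) 1 (tucker C₀ U₀ + (A t₁ - A t₀))‖ :=
        norm_sub_tucker_le hP _
    _ ≤ ∑ _ : Fin d, (2 * L * (‖tucker C₀ U₀ - A t₀‖ + 2 * B * (t₁ - t₀)) + ε) * (t₁ - t₀) :=
        Finset.sum_le_sum fun i _ => (hbasis i).mode_defect_le hr ht hF hU₀ hρ
    _ = θ := by simpa using hθ

theorem IsStep.error_propagation_le (hr : (rankManifold r r).Nonempty) (ht : t₀ ≤ t₁)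
    (hε : 0 ≤ ε) (hF : IsNearlyTangentialFlow r F A (Icc t₀ t₁) L B ε ρ)
    (hρ : ‖Y₀ - A t₀‖ + 2 * B * (t₁ - t₀) < ρ) (h : IsStep r F t₀ t₁ Y₀ Y₁) {D : ℝ}
    (hD : d * (1 + L * (t₁ - t₀)) ≤ D) :
    ‖Y₁ - A t₁‖ ≤ (1 + (t₁ - t₀) * (L * (2 * D + 1))) * ‖Y₀ - A t₀‖ +
      (t₁ - t₀) * (D * ε + 4 * L * B * (D + 1) * (t₁ - t₀)) := by
  have hlocal := h.local_error_le hr ht hF hρ rfl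
  have hτ : 0 ≤ t₁ - t₀ := sub_nonneg.2 ht
  set e := ‖Y₀ - A t₀‖ with he
  set τ := t₁ - t₀
  set μ := (2 * L * (e + 2 * B * τ) + ε) * τ with hμ
  have hDμ : d * (1 + L * τ) * μ ≤ D * μ := by gcongr
  calc ‖Y₁ - A t₁‖ = ‖(Y₁ - (Y₀ + (A t₁ - A t₀))) + (Y₀ - A t₀)‖ := by congr 1; abel
    _ ≤ (d * μ + L * (e + 4 * B * τ + d * μ) * τ) + e := norm_add_le_of_le hlocal he.ge
    _ = d * (1 + L * τ) * μ + (1 + τ * L) * e + 4 * L * B * τ * τ := by ring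
    _ ≤ D * μ + (1 + τ * L) * e + 4 * L * B * τ * τ := by gcongr
    _ = _ := by rw [hμ]; ring

theorem error_le_of_isStep {T D δ h : ℝ} {Y : ℕ → Tensor n} (hr : (rankManifold r r).Nonempty)
    (hF : IsNearlyTangentialFlow r F A (Icc 0 T) L B ε ρ) (hε : 0 ≤ ε) (hδ : ‖Y 0 - A 0‖ ≤ δ)
    (hh : 0 < h) (hstep : ∀ k : ℕ, (k + 1) * h ≤ T →
      IsStep r F (k * h) ((k + 1) * h) (Y k) (Y (k + 1)))
    (hD : d * (1 + L * T) ≤ D)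
    (hρ : Real.exp (T * (L * (2 * D + 1))) * (δ + T * (D * ε + 4 * L * B * (D + 1) * h)) +
      2 * B * h < ρ) {k : ℕ} (hk : k * h ≤ T) :
    ‖Y k - A (k * h)‖ ≤
      Real.exp (T * (L * (2 * D + 1))) * (δ + T * (D * ε + 4 * L * B * (D + 1) * h)) := by
  have hT : 0 ≤ T := le_trans (by positivity) hk
  have hD0 : 0 ≤ D := le_trans (by positivity) hD
  have hbound : Real.exp (k * (h * (L * (2 * D + 1)))) *
      (‖Y 0 - A ((0 : ℕ) * h)‖ + k * (h * (D * ε + 4 * L * B * (D + 1) * h))) ≤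
      Real.exp (T * (L * (2 * D + 1))) * (δ + T * (D * ε + 4 * L * B * (D + 1) * h)) := by
    rw [← mul_assoc, ← mul_assoc (k : ℝ), Nat.cast_zero, zero_mul]
    gcongr
  refine (discrete_gronwall_of_le (e := fun k => ‖Y k - A (k * h)‖) (fun k => norm_nonneg _)
    (by positivity) (by positivity) hbound fun j hj hje => ?_).trans hbound
  have hjk : (j + 1) * h ≤ T := by
    refine le_trans ?_ hk
    gcongr
    exact_mod_cast hj
  have hjh : (j + 1) * h - j * h = h := by ring
  have hsub : Icc (j * h) ((j + 1) * h) ⊆ Icc 0 T := Icc_subset_Icc (by positivity) hjk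
  have hprop := (hstep j hjk).error_propagation_le hr (by linarith) hε (hF.mono hsub)
    (by rw [hjh]; linarith) (D := D) ?_
  · rw [hjh] at hprop
    exact_mod_cast hprop
  · rw [hjh]
    have hhT : h ≤ T := (le_mul_of_one_le_left hh.le (by simp)).trans hjk
    exact le_trans (by gcongr) hD

end Integrator

end TuckerIntegrator

end

open Set TuckerIntegrator in
theorem theorem7_general (d : ℕ) (L B T : ℝ) :
    ∃ c₀ c₁ c₂ : ℝ, 0 ≤ c₀ ∧ 0 ≤ c₁ ∧ 0 ≤ c₂ ∧
      ∀ (n r : Fin d → ℕ)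
        (F : ℝ → Tensor n → Tensor n) (A : ℝ → Tensor n) (Y : ℕ → Tensor n)
        (ε δ h ρ : ℝ),
        (∀ t ∈ Icc 0 T, HasDerivWithinAt A (F t (A t)) (Icc 0 T) t) →
        (∀ t ∈ Icc 0 T, ∀ X X', ‖F t X - F t X'‖ ≤ L * ‖X - X'‖) →
        (∀ t ∈ Icc 0 T, ∀ X, ‖F t X‖ ≤ B) →
        0 ≤ ε →
        (∀ t ∈ Icc 0 T, ∀ X ∈ rankManifold n r, ‖X - A t‖ < ρ →
          ‖F t X - tangentProj r X (F t X)‖ ≤ ε) →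
        (rankManifold n r).Nonempty →
        ‖Y 0 - A 0‖ ≤ δ →
        0 < h →
        (∀ k : ℕ, ((k : ℝ) + 1) * h ≤ T →
          IsStep r F ((k : ℝ) * h) (((k : ℝ) + 1) * h) (Y k) (Y (k + 1))) →
        c₀ * δ + c₁ * ε + c₂ * h ≤ ρ →
        ∀ k : ℕ, (k : ℝ) * h ≤ T → ‖Y k - A ((k : ℝ) * h)‖ ≤ c₀ * δ + c₁ * ε + c₂ * h := by
  obtain hT | hT := lt_or_ge T 0
  · refine ⟨0, 0, 0, le_rfl, le_rfl, le_rfl, ?_⟩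
    intro n r F A Y ε δ h ρ _ _ _ _ _ _ _ hh _ _ k hk
    exact absurd ((mul_nonneg k.cast_nonneg hh.le).trans hk) hT.not_ge
  let L' := L.toNNReal
  let B' := B.toNNReal
  let D := d * (1 + L' * T)
  let E := Real.exp (T * (L' * (2 * D + 1)))
  refine ⟨E, E * (T * D), E * (T * (4 * L' * B' * (D + 1))) + 2 * B' + 1, by positivity,
    by positivity, by positivity, ?_⟩
  intro n r F A Y ε δ h ρ hA hL hB hε hFε hM hδ hh hstep hρ k hk
  have hF : IsNearlyTangentialFlow r F A (Icc 0 T) L' B' ε ρ :=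
    ⟨hA, fun t ht => .of_dist_le' fun X X' => by simpa only [dist_eq_norm] using hL t ht X X',
      fun t ht X => (hB t ht X).trans (Real.le_coe_toNNReal B), hFε⟩
  have hBh : 0 ≤ 2 * B' * h := by positivity
  have herr := error_le_of_isStep (nonempty_rankManifold_self hM) hF hε hδ hh hstep le_rfl
    (by linarith) hk
  linarith

theorem theorem7 (d : ℕ) (L B T : ℝ) :
    ∃ c₀ c₁ c₂ : ℝ, 0 ≤ c₀ ∧ 0 ≤ c₁ ∧ 0 ≤ c₂ ∧
      ∀ (n r : Fin d → ℕ)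
        (F : ℝ → TuckerIntegrator.Tensor n → TuckerIntegrator.Tensor n)
        (A : ℝ → TuckerIntegrator.Tensor n) (Y : ℕ → TuckerIntegrator.Tensor n)
        (ε δ h ρ : ℝ),
        -- `A` solves the full differential equation on `[0, T]`
        (∀ t ∈ Set.Icc 0 T, HasDerivWithinAt A (F t (A t)) (Set.Icc 0 T) t) →
        -- `F` is Lipschitz continuous and bounded
        (∀ t ∈ Set.Icc 0 T, ∀ X X', ‖F t X - F t X'‖ ≤ L * ‖X - X'‖) →
        (∀ t ∈ Set.Icc 0 T, ∀ X, ‖F t X‖ ≤ B) →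
        -- the non-tangential part is `ε`-small in the `ρ`-neighbourhood of the solution
        0 ≤ ε → 0 < ρ →
        (∀ t ∈ Set.Icc 0 T, ∀ X ∈ TuckerIntegrator.rankManifold n r, ‖X - A t‖ < ρ →
          ‖F t X - TuckerIntegrator.tangentProj r X (F t X)‖ ≤ ε) →
        -- the initial error is `δ`-small
        Y 0 ∈ TuckerIntegrator.rankManifold n r →
        ‖Y 0 - A 0‖ ≤ δ →
        -- `Y` is produced by the integrator with step size `h`
        0 < h →
        (∀ k : ℕ, ((k : ℝ) + 1) * h ≤ T →
          TuckerIntegrator.IsStep r F ((k : ℝ) * h) (((k : ℝ) + 1) * h) (Y k) (Y (k + 1))) →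
        -- the neighbourhood is not smaller than the error bound
        c₀ * δ + c₁ * ε + c₂ * h ≤ ρ →
        ∀ k : ℕ, (k : ℝ) * h ≤ T → ‖Y k - A ((k : ℝ) * h)‖ ≤ c₀ * δ + c₁ * ε + c₂ * h := by
  obtain ⟨c₀, c₁, c₂, h₀, h₁, h₂, hc⟩ := theorem7_general d L B T
  exact ⟨c₀, c₁, c₂, h₀, h₁, h₂, fun n r F A Y ε δ h ρ hA hL hB hε _ hFε hY₀ =>
    hc n r F A Y ε δ h ρ hA hL hB hε hFε ⟨Y 0, hY₀⟩⟩
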